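/- Conventions. Let $X$ be a Banach space over $\mathbb R$ or $\mathbb C$, with closed unit ball $B_X$ and dual $X^*$; let $\omega_1$ be the first uncountable ordinal. All products and powers of ordinals are the usual ones ($\alpha\beta$ is $\beta$ copies of $\alpha$), and limit ordinals are non-zero. For a set $\mathcal H$ of finite sequences in $B_X$ (the empty sequence is allowed), let $\mathcal H'_w$ be the set of all $t\in\mathcal H$ for which there is a weakly null sequence $(s_i)_{i\ge 1}$ in $B_X$ with $t^\frown s_i\in\mathcal H$ for every $i$. Put $\mathcal H^0_w=\mathcal H$, $\mathcal H^{\xi+1}_w=(\mathcal H^{\xi}_w)'_w$, and $\mathcal H^\xi_w=\bigcap_{\zeta<\xi}\mathcal H^\zeta_w$ for limit $\xi$. Let $I_w(\mathcal H)$ be the least $\xi<\omega_1$ with $\mathcal H^\xi_w=\varnothing$ if there is one, and $I_w(\mathcal H)=\omega_1$ otherwise. For $\varepsilon>0$ let $\mathcal H^X_\varepsilon$ be the set of all finite sequences $(x_i)_{i=1}^n$ in $B_X$ for which some $x^*\in B_{X^*}$ satisfies $\operatorname{Re}x^*(x_i)\ge\varepsilon$ for all $i\le n$. For a bounded set $L\subset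 X^*$ and $\varepsilon>0$, let $s_\varepsilon(L)$ be the set of all $x^*\in X^*$ such that $\operatorname{diam}_{\|\cdot\|}(V\cap L)>\varepsilon$ for every weak$^*$ neighbourhood $V$ of $x^*$; define $s^\xi_\varepsilon(L)$ by transfinite iteration, with intersections at limit ordinals, as above. Let $Sz_\varepsilon(L)$ be the least $\xi<\omega_1$ with $s_\varepsilon^\xi(L)=\varnothing$ if there is one, and $\omega_1$ otherwise. Let $Sz(X)=\sup_{\varepsilon>0}Sz_\varepsilon(B_{X^*})$. Theorem. Let $X$ be a Banach space whose dual is norm separable. 1. For all $\varepsilon,\delta\in(0,1)$, $$I_w(\mathcal H^X_{\varepsilon\delta})\le I_w(\mathcal H^X_\varepsilon)\,I_w(\mathcal H^X_\delta).$$ 2. For all $\varepsilon,\delta\in(0,1)$ and every ordinal $\xi$, if $I_w(\mathcal H^X_\varepsilon)>\omega^{\omega^\xi}$, then $I_w(\mathcal H^X_\delta)>\omega^{\omega^\xi}$. 3. In particular, $Sz(X)\ne\omega^{\omega^\eta}$ for every limit ordinal $\eta<\omega_1$. Moreover, for every Banach space $Y$ (with no separability assumption) and every limit ordinal $\eta<\omega_1$,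 $Sz(Y)\neq\omega^{\omega^\eta}$. -/

import Mathlib

open Set Filter Topology
open scoped Ordinal

noncomputable section

/-! ### Transfinite derivatives and the associated ordinal index -/

/-- The transfinite iterates `L^ξ` of an operation `D` on sets: `L^0 = L`, `L^(ξ+1) = D (L^ξ)`,
and `L^ξ = ⋂ ζ < ξ, L^ζ` for limit `ξ`. -/
def transfiniteDerivative {α : Type*} (D : Set α → Set α) (L : Set α) (ξ : Ordinal.{0}) : Set α :=
  Ordinal.limitRecOn ξ L (fun _ S => D S) (fun ξ _ ih => ⋂ ζ, ⋂ h : ζ < ξ, ih ζ h)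

/-- The least countable ordinal `ξ` for which the `ξ`-th derivative is empty, and `ω₁` if there is
no such countable ordinal. -/
def derivativeIndex {α : Type*} (D : Set α → Set α) (L : Set α) : Ordinal.{0} :=
  sInf (insert ω₁ {ξ : Ordinal.{0} | ξ < ω₁ ∧ transfiniteDerivative D L ξ = ∅})

/-! ### The Szlenk index -/

/-- The Szlenk derivation `s_ε(L)`: all functionals each of whose weak-star neighbourhoods `V`
satisfies `diam (V ∩ L) > ε`, the diameter being taken in the dual norm. -/
def szlenkDerivative (𝕜 : Type*) [RCLike 𝕜] (X : Type*) [NormedAddCommGroup X] [NormedSpace 𝕜 X]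
    (ε : ℝ) (L : Set (StrongDual 𝕜 X)) : Set (StrongDual 𝕜 X) :=
  {f | ∀ V ∈ 𝓝 (StrongDual.toWeakDual f),
    ENNReal.ofReal ε < Metric.ediam ((StrongDual.toWeakDual ⁻¹' V) ∩ L)}

/-- `Sz_ε(L)`. -/
def szlenkIndexAt (𝕜 : Type*) [RCLike 𝕜] (X : Type*) [NormedAddCommGroup X] [NormedSpace 𝕜 X]
    (ε : ℝ) (L : Set (StrongDual 𝕜 X)) : Ordinal.{0} :=
  derivativeIndex (szlenkDerivative 𝕜 X ε) L

/-- The Szlenk index `Sz(X) = sup_{ε > 0} Sz_ε(B_{X^*})`.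
The supremum is that of a set of ordinals bounded by `ω₁`. -/
def szlenkIndex (𝕜 : Type*) [RCLike 𝕜] (X : Type*) [NormedAddCommGroup X] [NormedSpace 𝕜 X] :
    Ordinal.{0} :=
  ⨆ ε : Set.Ioi (0 : ℝ), szlenkIndexAt 𝕜 X ε (Metric.closedBall 0 1)

/-! ### The weakly null index -/

/-- For a collection `σ` of infinite sequences in `S`, the `σ`-derivative of a set `H` of finite
sequences in `S`: those `t ∈ H` for which some `s ∈ σ` satisfies `t⌢(s i) ∈ H` for every `i`. -/
def sigmaDerivative {S : Type*} (σ : Set (ℕ → S)) (H : Set (List S)) : Set (List S) :=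
  {t | t ∈ H ∧ ∃ s ∈ σ, ∀ i, t ++ [s i] ∈ H}

/-- The weakly null sequences in the closed unit ball of `X`. -/
def weaklyNullSequences (𝕜 : Type*) [RCLike 𝕜] (X : Type*) [NormedAddCommGroup X]
    [NormedSpace 𝕜 X] : Set (ℕ → X) :=
  {x | (∀ n, ‖x n‖ ≤ 1) ∧ ∀ f : StrongDual 𝕜 X, Tendsto (fun n => f (x n)) atTop (𝓝 0)}

/-- The weakly null index `I_w(H)`. -/
def weaklyNullIndex (𝕜 : Type*) [RCLike 𝕜] {X : Type*} [NormedAddCommGroup X] [NormedSpace 𝕜 X]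
    (H : Set (List X)) : Ordinal.{0} :=
  derivativeIndex (sigmaDerivative (weaklyNullSequences 𝕜 X)) H

/-- The tree `H^X_ε` of all finite sequences `(x_1, …, x_n)` in the closed unit ball of `X` such
that some `f` in the closed unit ball of the dual has `f(x_i) ≥ ε` for every `i`
(for complex scalars: `Re f(x_i) ≥ ε`). -/
def lowerEstimateTree (𝕜 : Type*) [RCLike 𝕜] (X : Type*) [NormedAddCommGroup X] [NormedSpace 𝕜 X]
    (ε : ℝ) : Set (List X) :=
  {t | (∀ x ∈ t, ‖x‖ ≤ 1) ∧
    ∃ f ∈ Metric.closedBall (0 : StrongDual 𝕜 X) 1, ∀ x ∈ t, ε ≤ RCLike.re (f x)}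

end

/-!
Both indices are submultiplicative, by different arguments, and the rest is ordinal arithmetic.

*The Szlenk index.* Suppose that `f` survives `α = Sz_ε(B)` further `εδ`-derivations of some
`K = s_{εδ}^γ(B)`. If `f` had a weak-star neighbourhood `V` with `diam (V ∩ K) ≤ δ`, then `V ∩ K`
would lie in `f + δB`, and the `εδ`-derivations of a subset of `f + δB` vanish after `α` steps by
translation and scaling. Hence `s_{εδ}^{γ+α}(B) ⊆ s_δ(s_{εδ}^γ(B))`
(`transfiniteDerivative_szlenkDerivative_add_subset`), so that `s_{εδ}^{αξ}(B) ⊆ s_δ^ξ(B)` and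
`Sz_{εδ} ≤ Sz_ε · Sz_δ`. No separability is involved.

*The weakly null index.* This is James' blocking argument along a tree. If a node `t` survives
`α = I_w(H_ε)` derivations of a derivative of `H_{εδ}`, then `t` extends within that derivative by a
block `u ∉ H_ε` with entries in any prescribed weak neighbourhood of `0`
(`exists_append_mem_transfiniteDerivative`). By Hahn–Banach, `u` has a convex combination `y` with
`‖y‖ < ε` (`exists_mem_convexHull_norm_lt`), and `ε⁻¹ y` lies in the unit ball and inherits a lower
`δ`-estimate from the lower `εδ`-estimate on `u`. Separability of the dual lets these `y` be chosen
to form a weakly null sequence (`exists_weak_nhds_basis`), so surviving `α` derivations of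
`H_{εδ}` entails surviving one derivation of `H_δ`
(`mem_transfiniteDerivative_lowerEstimateTree_of_mul`).

*Ordinals.* Since `ω ^ ω ^ ξ` is closed under products, a submultiplicative index that is below
`ω ^ ω ^ ξ` at one `δ < 1` is below it at every `ε > 0`
(`lt_omega0_opow_omega0_opow_of_submultiplicative`). Neither index at a fixed `ε` is a countable
limit ordinal: for trees the empty sequence survives at limit stages, and for the Szlenk derivation
this is weak-star compactness of the ball. So an index that is at most `ω ^ ω ^ ξ < ω₁` is strictly
below it, which gives the dichotomy for `I_w`. If `Sz(X) = ω ^ ω ^ η` with `η` a limit, then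
`Sz_{1/2}` is below some `ω ^ ω ^ ζ` with `ζ < η`, hence so is every `Sz_ε`, and
`Sz(X) ≤ ω ^ ω ^ ζ`, a contradiction.
-/

/-! ### Transfinite iteration of a derivation -/

section TransfiniteDerivative

variable {α : Type*} {D D' : Set α → Set α} {L L' : Set α}

theorem transfiniteDerivative_zero (D : Set α → Set α) (L : Set α) :
    transfiniteDerivative D L 0 = L :=
  Ordinal.limitRecOn_zero ..

theorem transfiniteDerivative_add_one (D : Set α → Set α) (L : Set α) (ξ : Ordinal.{0}) :
    transfiniteDerivative D L (ξ + 1) = D (transfiniteDerivative D L ξ) :=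
  Ordinal.limitRecOn_add_one ..

theorem transfiniteDerivative_limit (D : Set α → Set α) (L : Set α) {ξ : Ordinal.{0}}
    (hξ : Order.IsSuccLimit ξ) :
    transfiniteDerivative D L ξ = ⋂ ζ, ⋂ _ : ζ < ξ, transfiniteDerivative D L ζ :=
  Ordinal.limitRecOn_limit (h := hξ) ..

theorem mem_transfiniteDerivative_limit {ξ : Ordinal.{0}} (hξ : Order.IsSuccLimit ξ) {x : α} :
    x ∈ transfiniteDerivative D L ξ ↔ ∀ ζ < ξ, x ∈ transfiniteDerivative D L ζ := by
  rw [transfiniteDerivative_limit D L hξ, mem_iInter₂]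

theorem transfiniteDerivative_mono (hD : ∀ S T, S ⊆ T → D S ⊆ D' T) (hL : L ⊆ L')
    (ξ : Ordinal.{0}) : transfiniteDerivative D L ξ ⊆ transfiniteDerivative D' L' ξ := by
  induction ξ using Ordinal.limitRecOn with
  | zero => simpa only [transfiniteDerivative_zero] using hL
  | add_one ξ ih => simpa only [transfiniteDerivative_add_one] using hD _ _ ih
  | limit ξ hξ ih =>
    intro x hx
    rw [mem_transfiniteDerivative_limit hξ] at hx ⊢
    exact fun ζ hζ => ih ζ hζ (hx ζ hζ)

theorem transfiniteDerivative_antitone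
    (hD : ∀ ξ, D (transfiniteDerivative D L ξ) ⊆ transfiniteDerivative D L ξ) :
    Antitone (transfiniteDerivative D L) := by
  intro ζ ξ
  induction ξ using Ordinal.limitRecOn with
  | zero => intro h; rw [nonpos_iff_eq_zero.1 h]
  | add_one ξ ih =>
    intro h
    rcases h.eq_or_lt with rfl | h
    · exact le_rfl
    · rw [transfiniteDerivative_add_one]
      exact (hD ξ).trans (ih (Order.lt_add_one_iff.1 h))
  | limit ξ hξ ih =>
    intro h
    rcases h.eq_or_lt with rfl | h
    · exact le_rfl
    · exact fun x hx => (mem_transfiniteDerivative_limit hξ).1 hx ζ h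

theorem derivativeIndex_le_omega_one (D : Set α → Set α) (L : Set α) :
    derivativeIndex D L ≤ ω₁ :=
  csInf_le' (mem_insert _ _)

theorem derivativeIndex_le_of_eq_empty {ξ : Ordinal.{0}} (h : transfiniteDerivative D L ξ = ∅) :
    derivativeIndex D L ≤ ξ := by
  rcases lt_or_ge ξ ω₁ with hξ | hξ
  · exact csInf_le' (mem_insert_of_mem _ ⟨hξ, h⟩)
  · exact (derivativeIndex_le_omega_one D L).trans hξ

theorem transfiniteDerivative_derivativeIndex (h : derivativeIndex D L < ω₁) :
    transfiniteDerivative D L (derivativeIndex D L) = ∅ := by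
  have hmem : derivativeIndex D L ∈ insert ω₁ {ξ : Ordinal.{0} | ξ < ω₁ ∧
      transfiniteDerivative D L ξ = ∅} := csInf_mem (insert_nonempty _ _)
  rcases hmem with h' | h'
  · exact absurd h' h.ne
  · exact h'.2

theorem derivativeIndex_mono (hD : ∀ S T, S ⊆ T → D S ⊆ D' T) (hL : L ⊆ L') :
    derivativeIndex D L ≤ derivativeIndex D' L' := by
  rcases (derivativeIndex_le_omega_one D' L').lt_or_eq with h | h
  · refine derivativeIndex_le_of_eq_empty (subset_empty_iff.1 ?_)
    rw [← transfiniteDerivative_derivativeIndex h]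
    exact transfiniteDerivative_mono hD hL _
  · exact h ▸ derivativeIndex_le_omega_one D L

theorem derivativeIndex_ne_zero (hL : L.Nonempty) : derivativeIndex D L ≠ 0 := by
  intro h
  have h' := transfiniteDerivative_derivativeIndex (D := D) (L := L)
    (h ▸ Ordinal.omega0_pos.trans Ordinal.omega0_lt_omega_one)
  rw [h, transfiniteDerivative_zero] at h'
  exact hL.ne_empty h'

theorem derivativeIndex_le_mul {β γ : Type*} {D₁ : Set β → Set β} {L₁ : Set β}
    {D₂ : Set γ → Set γ} {L₂ : Set γ} (h₁ : L₁.Nonempty) (h₂ : L₂.Nonempty)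
    (h : ∀ a, transfiniteDerivative D₁ L₁ a = ∅ → ∀ b, transfiniteDerivative D₂ L₂ b = ∅ →
      transfiniteDerivative D L (a * b) = ∅) :
    derivativeIndex D L ≤ derivativeIndex D₁ L₁ * derivativeIndex D₂ L₂ := by
  rcases (derivativeIndex_le_omega_one D₁ L₁).lt_or_eq with ha | ha
  · rcases (derivativeIndex_le_omega_one D₂ L₂).lt_or_eq with hb | hb
    · exact derivativeIndex_le_of_eq_empty (h _ (transfiniteDerivative_derivativeIndex ha) _
        (transfiniteDerivative_derivativeIndex hb))
    · refine (derivativeIndex_le_omega_one D L).trans (hb ▸ ?_)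
      exact Ordinal.le_mul_right _ (pos_iff_ne_zero.2 (derivativeIndex_ne_zero h₁))
  · refine (derivativeIndex_le_omega_one D L).trans (ha ▸ ?_)
    exact Ordinal.le_mul_left _ (pos_iff_ne_zero.2 (derivativeIndex_ne_zero h₂))

/-- If nonemptiness of the iterates passes to limit stages, a countable index is not a limit. -/
theorem not_isSuccLimit_derivativeIndex (h : derivativeIndex D L < ω₁)
    (hlim : ∀ ξ : Ordinal.{0}, Order.IsSuccLimit ξ →
      (∀ ζ < ξ, (transfiniteDerivative D L ζ).Nonempty) →
        (transfiniteDerivative D L ξ).Nonempty) :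
    ¬ Order.IsSuccLimit (derivativeIndex D L) := by
  intro hl
  refine (hlim _ hl fun ζ hζ => ?_).ne_empty (transfiniteDerivative_derivativeIndex h)
  by_contra hne
  exact hζ.not_ge (derivativeIndex_le_of_eq_empty (not_nonempty_iff_eq_empty.1 hne))

/-- If `a` further steps of `D` reduce the iterate `D^γ` to a subset of `D' (D^γ)`, whatever `γ`,
then every `a` steps of `D` amount to at least one step of `D'`. -/
theorem transfiniteDerivative_mul_subset (hanti : Antitone (transfiniteDerivative D L))
    (hD' : ∀ S T, S ⊆ T → D' S ⊆ D' T) {a : Ordinal.{0}}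
    (hstep : ∀ γ, transfiniteDerivative D L (γ + a) ⊆ D' (transfiniteDerivative D L γ))
    (ξ : Ordinal.{0}) : transfiniteDerivative D L (a * ξ) ⊆ transfiniteDerivative D' L ξ := by
  induction ξ using Ordinal.limitRecOn with
  | zero => simp only [mul_zero, transfiniteDerivative_zero, subset_rfl]
  | add_one ξ ih =>
    rw [mul_add_one, transfiniteDerivative_add_one]
    exact (hstep _).trans (hD' _ _ ih)
  | limit ξ hξ ih =>
    intro x hx
    rw [mem_transfiniteDerivative_limit hξ]
    exact fun ζ hζ => ih ζ hζ (hanti (mul_le_mul_right hζ.le a) hx)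

end TransfiniteDerivative

/-! ### Ordinal arithmetic -/

theorem isSuccLimit_omega0_opow_omega0_opow (ξ : Ordinal.{0}) :
    Order.IsSuccLimit (ω ^ ω ^ ξ : Ordinal.{0}) :=
  Ordinal.isSuccLimit_opow_left Ordinal.isSuccLimit_omega0
    (Ordinal.opow_pos ξ Ordinal.omega0_pos).ne'

theorem omega0_opow_omega0_opow_lt_omega_one {η : Ordinal.{0}} (hη : η < ω₁) :
    (ω ^ ω ^ η : Ordinal.{0}) < ω₁ :=
  Ordinal.isPrincipal_opow_omega 1 Ordinal.omega0_lt_omega_one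
    (Ordinal.isPrincipal_opow_omega 1 Ordinal.omega0_lt_omega_one hη)

/-- For a submultiplicative index, a bound `ω ^ ω ^ ξ` at a single `δ < 1` holds at every `ε > 0`,
because `ω ^ ω ^ ξ` is closed under products and the powers of `δ` tend to `0`. -/
theorem lt_omega0_opow_omega0_opow_of_submultiplicative {I : ℝ → Ordinal.{0}} (hI : Antitone I)
    (hsub : ∀ ε ∈ Ioo (0 : ℝ) 1, ∀ δ ∈ Ioo (0 : ℝ) 1, I (ε * δ) ≤ I ε * I δ)
    {ξ : Ordinal.{0}} {δ : ℝ} (hδ : δ ∈ Ioo (0 : ℝ) 1) (h : I δ < ω ^ ω ^ ξ) {ε : ℝ}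
    (hε : 0 < ε) : I ε < ω ^ ω ^ ξ := by
  have hpow : ∀ n : ℕ, I (δ ^ (n + 1)) < ω ^ ω ^ ξ := by
    intro n
    induction n with
    | zero => simpa using h
    | succ n ih =>
      rw [pow_succ]
      exact (hsub _ ⟨pow_pos hδ.1 _, pow_lt_one₀ hδ.1.le hδ.2 n.succ_ne_zero⟩ _ hδ).trans_lt
        (Ordinal.isPrincipal_mul_omega0_opow_opow ξ ih h)
  obtain ⟨n, hn⟩ := exists_pow_lt_of_lt_one hε hδ.2
  exact (hI ((pow_le_pow_of_le_one hδ.1.le hδ.2.le n.le_succ).trans hn.le)).trans_lt (hpow n)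

/-! ### The Szlenk derivation -/

section Szlenk

variable {𝕜 : Type*} [RCLike 𝕜] {X : Type*} [NormedAddCommGroup X] [NormedSpace 𝕜 X]

theorem szlenkDerivative_mono {ε δ : ℝ} (h : δ ≤ ε) (S T : Set (StrongDual 𝕜 X)) (hST : S ⊆ T) :
    szlenkDerivative 𝕜 X ε S ⊆ szlenkDerivative 𝕜 X δ T := fun _ hf V hV =>
  (ENNReal.ofReal_le_ofReal h).trans_lt
    ((hf V hV).trans_le (Metric.ediam_mono (inter_subset_inter_right _ hST)))

theorem isClosed_szlenkDerivative (ε : ℝ) (L : Set (StrongDual 𝕜 X)) :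
    IsClosed (WeakDual.toStrongDual ⁻¹' szlenkDerivative 𝕜 X ε L) := by
  rw [← isOpen_compl_iff, isOpen_iff_mem_nhds]
  intro f hf
  simp only [mem_compl_iff, mem_preimage, szlenkDerivative, mem_ofPred_eq, not_forall] at hf
  obtain ⟨V, hV, hd⟩ := hf
  filter_upwards [eventually_mem_nhds_iff.2 hV] with g hg hg'
  exact hd (hg' V hg)

theorem szlenkDerivative_subset {ε : ℝ} {L : Set (StrongDual 𝕜 X)}
    (hL : IsClosed (WeakDual.toStrongDual ⁻¹' L)) : szlenkDerivative 𝕜 X ε L ⊆ L := by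
  intro f hf
  by_contra hfL
  have h := hf _ (hL.isOpen_compl.mem_nhds (x := StrongDual.toWeakDual f) hfL)
  have he : StrongDual.toWeakDual ⁻¹' (WeakDual.toStrongDual ⁻¹' L)ᶜ ∩ L = ∅ :=
    eq_empty_of_forall_notMem fun g hg => hg.1 hg.2
  rw [he, Metric.ediam_empty] at h
  exact not_lt_zero h

theorem isClosed_transfiniteDerivative_szlenkDerivative (ε : ℝ) {L : Set (StrongDual 𝕜 X)}
    (hL : IsClosed (WeakDual.toStrongDual ⁻¹' L)) (ξ : Ordinal.{0}) :
    IsClosed (WeakDual.toStrongDual ⁻¹' transfiniteDerivative (szlenkDerivative 𝕜 X ε) L ξ) := by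
  induction ξ using Ordinal.limitRecOn with
  | zero => rwa [transfiniteDerivative_zero]
  | add_one ξ ih =>
    rw [transfiniteDerivative_add_one]
    exact isClosed_szlenkDerivative ε _
  | limit ξ hξ ih =>
    rw [transfiniteDerivative_limit _ _ hξ]
    simp only [preimage_iInter]
    exact isClosed_iInter fun ζ => isClosed_iInter fun hζ => ih ζ hζ

theorem antitone_transfiniteDerivative_szlenkDerivative (ε : ℝ) {L : Set (StrongDual 𝕜 X)}
    (hL : IsClosed (WeakDual.toStrongDual ⁻¹' L)) :
    Antitone (transfiniteDerivative (szlenkDerivative 𝕜 X ε) L) :=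
  transfiniteDerivative_antitone fun ξ =>
    szlenkDerivative_subset (isClosed_transfiniteDerivative_szlenkDerivative ε hL ξ)

theorem antitone_szlenkIndexAt (L : Set (StrongDual 𝕜 X)) :
    Antitone fun ε => szlenkIndexAt 𝕜 X ε L := fun _ _ h =>
  derivativeIndex_mono (szlenkDerivative_mono h) subset_rfl

theorem nonempty_transfiniteDerivative_szlenkDerivative_limit (ε : ℝ) {ξ : Ordinal.{0}}
    (hξ : Order.IsSuccLimit ξ)
    (h : ∀ ζ < ξ, (transfiniteDerivative (szlenkDerivative 𝕜 X ε)
      (Metric.closedBall 0 1) ζ).Nonempty) :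
    (transfiniteDerivative (szlenkDerivative 𝕜 X ε) (Metric.closedBall 0 1) ξ).Nonempty := by
  have hcl := isClosed_transfiniteDerivative_szlenkDerivative (𝕜 := 𝕜) (X := X) ε
    (WeakDual.isClosed_closedBall 0 1)
  have hanti := antitone_transfiniteDerivative_szlenkDerivative (𝕜 := 𝕜) (X := X) ε
    (WeakDual.isClosed_closedBall 0 1)
  have : Nonempty (Iio ξ) := ⟨⟨0, hξ.bot_lt⟩⟩
  obtain ⟨f, hf⟩ := IsCompact.nonempty_iInter_of_directed_nonempty_isCompact_isClosed
    (fun ζ : Iio ξ => (WeakDual.toStrongDual ⁻¹' transfiniteDerivative (szlenkDerivative 𝕜 X ε)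
      (Metric.closedBall 0 1) ζ.1 : Set (WeakDual 𝕜 X)))
    (directed_of_isDirected_le fun ζ ζ' hζ => preimage_mono (hanti hζ))
    (fun ζ => h ζ.1 ζ.2)
    (fun ζ => (WeakDual.isCompact_closedBall 0 1).of_isClosed_subset (hcl _) (by
      have := hanti (zero_le (a := ζ.1))
      rw [transfiniteDerivative_zero] at this
      exact preimage_mono this))
    (fun ζ => hcl _)
  refine ⟨WeakDual.toStrongDual f, (mem_transfiniteDerivative_limit hξ).2 fun ζ hζ => ?_⟩
  exact mem_iInter.1 hf ⟨ζ, hζ⟩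

/-- Localisation: if `K = s_{εδ}^γ(L)` meets a weak-star open set `V` in a set of diameter at most
`δ`, then `V ∩ K` lies in a translate `f + δB` of a multiple of the unit ball, and further
`εδ`-derivations of `V ∩ K` are dominated by the `ε`-derivations of `B`. -/
theorem transfiniteDerivative_szlenkDerivative_add_subset {ε δ : ℝ} (hδ : 0 < δ)
    {L : Set (StrongDual 𝕜 X)} (hL : IsClosed (WeakDual.toStrongDual ⁻¹' L)) {a : Ordinal.{0}}
    (ha : transfiniteDerivative (szlenkDerivative 𝕜 X ε) (Metric.closedBall 0 1) a = ∅)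
    (γ : Ordinal.{0}) :
    transfiniteDerivative (szlenkDerivative 𝕜 X (ε * δ)) L (γ + a) ⊆
      szlenkDerivative 𝕜 X δ (transfiniteDerivative (szlenkDerivative 𝕜 X (ε * δ)) L γ) := by
  have hanti := antitone_transfiniteDerivative_szlenkDerivative (ε * δ) hL
  intro f hf
  by_contra hns
  simp only [szlenkDerivative, mem_ofPred_eq, not_forall, not_lt] at hns
  obtain ⟨V, hV, hd⟩ := hns
  obtain ⟨U, hUV, hU, hfU⟩ := mem_nhds_iff.1 hV
  have hfγ : f ∈ transfiniteDerivative (szlenkDerivative 𝕜 X (ε * δ)) L γ :=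
    hanti le_self_add hf
  let φ : StrongDual 𝕜 X → StrongDual 𝕜 X := fun h => ((δ⁻¹ : ℝ) : 𝕜) • (h - f)
  have hφ : Continuous fun h : WeakDual 𝕜 X =>
      StrongDual.toWeakDual (φ (WeakDual.toStrongDual h)) := by
    have h : Continuous fun h : WeakDual 𝕜 X => h - StrongDual.toWeakDual f :=
      continuous_id.sub continuous_const
    exact h.const_smul ((δ⁻¹ : ℝ) : 𝕜)
  have hφdist : ∀ g h, edist (φ g) (φ h) = ENNReal.ofReal δ⁻¹ * edist g h := by
    intro g h
    have hsub : φ g - φ h = ((δ⁻¹ : ℝ) : 𝕜) • (g - h) := by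
      ext x
      simp only [φ, sub_apply, smul_apply, smul_eq_mul]
      ring
    rw [edist_dist, edist_dist, dist_eq_norm, dist_eq_norm, hsub, norm_smul, RCLike.norm_ofReal,
      abs_of_pos (inv_pos.2 hδ), ENNReal.ofReal_mul (inv_nonneg.2 hδ.le)]
  have key : ∀ ξ : Ordinal.{0}, ∀ h ∈ transfiniteDerivative (szlenkDerivative 𝕜 X (ε * δ)) L
      (γ + ξ), StrongDual.toWeakDual h ∈ U →
      φ h ∈ transfiniteDerivative (szlenkDerivative 𝕜 X ε) (Metric.closedBall 0 1) ξ := by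
    intro ξ
    induction ξ using Ordinal.limitRecOn with
    | zero =>
      intro h hh hhU
      rw [add_zero] at hh
      rw [transfiniteDerivative_zero, mem_closedBall_zero_iff]
      have hedist : edist h f ≤ ENNReal.ofReal δ :=
        (Metric.edist_le_ediam_of_mem (s := StrongDual.toWeakDual ⁻¹' V ∩ _) (mem_inter (hUV hhU) hh) (mem_inter (hUV hfU) hfγ)).trans hd
      rw [edist_dist, ENNReal.ofReal_le_ofReal_iff hδ.le, dist_eq_norm] at hedist
      rw [norm_smul, RCLike.norm_ofReal, abs_of_pos (inv_pos.2 hδ), inv_mul_le_iff₀ hδ, mul_one]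
      exact hedist
    | add_one ξ ih =>
      intro h hh hhU
      rw [← add_assoc, transfiniteDerivative_add_one] at hh
      rw [transfiniteDerivative_add_one]
      intro W hW
      have hW' := hh _ (inter_mem (hφ.continuousAt.preimage_mem_nhds (t := W) hW)
        (hU.mem_nhds hhU))
      refine lt_of_lt_of_le ?_ (Metric.ediam_mono (s := φ '' (StrongDual.toWeakDual ⁻¹'
        (((fun h : WeakDual 𝕜 X => StrongDual.toWeakDual (φ (WeakDual.toStrongDual h))) ⁻¹' W) ∩ U)
          ∩ transfiniteDerivative (szlenkDerivative 𝕜 X (ε * δ)) L (γ + ξ))) ?_)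
      · by_contra hle
        refine hW'.not_ge (Metric.ediam_le fun g hg h hh => ?_)
        have h1 := (Metric.edist_le_ediam_of_mem (mem_image_of_mem φ hg)
          (mem_image_of_mem φ hh)).trans (not_lt.1 hle)
        rw [hφdist, ENNReal.ofReal_inv_of_pos hδ, mul_comm, ← div_eq_mul_inv,
          ENNReal.div_le_iff (ENNReal.ofReal_pos.2 hδ).ne' ENNReal.ofReal_ne_top] at h1
        rwa [mul_comm ε, ENNReal.ofReal_mul hδ.le, mul_comm]
      · rintro _ ⟨g, ⟨⟨hgW, hgU⟩, hg⟩, rfl⟩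
        exact ⟨hgW, ih g hg hgU⟩
    | limit ξ hξ ih =>
      intro h hh hhU
      rw [mem_transfiniteDerivative_limit hξ]
      exact fun ζ hζ => ih ζ hζ h (hanti (by gcongr) hh) hhU
  exact (ha ▸ key a f hf hfU : φ f ∈ (∅ : Set _))

theorem szlenkIndexAt_mul_le {ε δ : ℝ} (hδ : 0 < δ) :
    szlenkIndexAt 𝕜 X (ε * δ) (Metric.closedBall 0 1) ≤
      szlenkIndexAt 𝕜 X ε (Metric.closedBall 0 1) *
        szlenkIndexAt 𝕜 X δ (Metric.closedBall 0 1) := by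
  have hne : (Metric.closedBall (0 : StrongDual 𝕜 X) 1).Nonempty :=
    ⟨0, Metric.mem_closedBall_self zero_le_one⟩
  have hcl := WeakDual.isClosed_closedBall (𝕜 := 𝕜) (E := X) 0 1
  refine derivativeIndex_le_mul hne hne fun a ha b hb => subset_empty_iff.1 ?_
  rw [← hb]
  exact transfiniteDerivative_mul_subset (antitone_transfiniteDerivative_szlenkDerivative _ hcl)
    (szlenkDerivative_mono le_rfl)
    (transfiniteDerivative_szlenkDerivative_add_subset hδ hcl ha) b

theorem not_isSuccLimit_szlenkIndexAt {ε : ℝ}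
    (h : szlenkIndexAt 𝕜 X ε (Metric.closedBall 0 1) < ω₁) :
    ¬ Order.IsSuccLimit (szlenkIndexAt 𝕜 X ε (Metric.closedBall 0 1)) :=
  not_isSuccLimit_derivativeIndex h fun _ hξ =>
    nonempty_transfiniteDerivative_szlenkDerivative_limit ε hξ

theorem szlenkIndex_ne_omega0_opow_omega0_opow {η : Ordinal.{0}} (hη : Order.IsSuccLimit η)
    (hη₁ : η < ω₁) : szlenkIndex 𝕜 X ≠ ω ^ ω ^ η := by
  intro h
  have hhalf : (1 / 2 : ℝ) ∈ Ioo (0 : ℝ) 1 := by norm_num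
  have hle : szlenkIndexAt 𝕜 X (1 / 2) (Metric.closedBall 0 1) ≤ ω ^ ω ^ η :=
    h ▸ Ordinal.le_iSup (fun ε : Ioi (0 : ℝ) => szlenkIndexAt 𝕜 X ε (Metric.closedBall 0 1))
      ⟨1 / 2, hhalf.1⟩
  have hlt : szlenkIndexAt 𝕜 X (1 / 2) (Metric.closedBall 0 1) < ω ^ ω ^ η := by
    refine hle.lt_of_ne fun heq => ?_
    exact not_isSuccLimit_szlenkIndexAt (heq ▸ omega0_opow_omega0_opow_lt_omega_one hη₁)
      (heq ▸ isSuccLimit_omega0_opow_omega0_opow η)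
  -- As `η` is a limit, a single smaller exponent `ζ` bounds the index at `1 / 2`.
  obtain ⟨b, hb, hlt⟩ := (Ordinal.lt_opow_of_isSuccLimit Ordinal.omega0_ne_zero
    (Ordinal.isSuccLimit_opow Ordinal.one_lt_omega0 hη)).1 hlt
  obtain ⟨ζ, hζ, hb⟩ := (Ordinal.lt_opow_of_isSuccLimit Ordinal.omega0_ne_zero hη).1 hb
  replace hlt := hlt.trans ((Ordinal.opow_lt_opow_iff_right Ordinal.one_lt_omega0).2 hb)
  have hsup : szlenkIndex 𝕜 X ≤ ω ^ ω ^ ζ := Ordinal.iSup_le fun ε =>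
    (lt_omega0_opow_omega0_opow_of_submultiplicative (antitone_szlenkIndexAt _)
      (fun _ _ _ hδ => szlenkIndexAt_mul_le hδ.1) hhalf hlt ε.2).le
  rw [h] at hsup
  refine hsup.not_gt ?_
  rwa [Ordinal.opow_lt_opow_iff_right Ordinal.one_lt_omega0,
    Ordinal.opow_lt_opow_iff_right Ordinal.one_lt_omega0]

end Szlenk

/-! ### The weakly null derivation of trees -/

section SigmaDerivative

variable {S : Type*} {σ : Set (ℕ → S)}

theorem sigmaDerivative_mono (T U : Set (List S)) (h : T ⊆ U) :
    sigmaDerivative σ T ⊆ sigmaDerivative σ U :=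
  fun _ ⟨ht, s, hs, hts⟩ => ⟨h ht, s, hs, fun i => h (hts i)⟩

theorem sigmaDerivative_subset (T : Set (List S)) : sigmaDerivative σ T ⊆ T :=
  fun _ h => h.1

theorem antitone_transfiniteDerivative_sigmaDerivative (T : Set (List S)) :
    Antitone (transfiniteDerivative (sigmaDerivative σ) T) :=
  transfiniteDerivative_antitone fun _ => sigmaDerivative_subset _

/-- The derivatives of a tree that is closed under sublists are closed under sublists. -/
theorem mem_transfiniteDerivative_sigmaDerivative_of_sublist {T : Set (List S)}
    (hT : ∀ t ∈ T, ∀ u, u.Sublist t → u ∈ T) (ξ : Ordinal.{0}) :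
    ∀ t ∈ transfiniteDerivative (sigmaDerivative σ) T ξ, ∀ u, u.Sublist t →
      u ∈ transfiniteDerivative (sigmaDerivative σ) T ξ := by
  induction ξ using Ordinal.limitRecOn with
  | zero => simpa only [transfiniteDerivative_zero] using hT
  | add_one ξ ih =>
    simp only [transfiniteDerivative_add_one]
    rintro t ⟨ht, s, hs, hts⟩ u hu
    exact ⟨ih t ht u hu, s, hs, fun i => ih _ (hts i) _ (hu.append_right _)⟩
  | limit ξ hξ ih =>
    simp only [mem_transfiniteDerivative_limit hξ]
    exact fun t ht u hu ζ hζ => ih ζ hζ t (ht ζ hζ) u hu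

theorem not_isSuccLimit_derivativeIndex_sigmaDerivative {T : Set (List S)}
    (hT : ∀ t ∈ T, ∀ u, u.Sublist t → u ∈ T)
    (h : derivativeIndex (sigmaDerivative σ) T < ω₁) :
    ¬ Order.IsSuccLimit (derivativeIndex (sigmaDerivative σ) T) :=
  not_isSuccLimit_derivativeIndex h fun _ hξ hne =>
    ⟨[], (mem_transfiniteDerivative_limit hξ).2 fun ζ hζ =>
      mem_transfiniteDerivative_sigmaDerivative_of_sublist hT ζ _ (hne ζ hζ).some_mem _
        (List.nil_sublist _)⟩

/-- A node `t` in the `(γ + a)`-th derivative of `T` has an extension `t ++ u` in the `γ`-th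
derivative with `u ∉ H`, where `a` bounds the index of `H`; and the entries of `u` can be
drawn from any set `U` that eventually contains every sequence of `σ`. -/
theorem exists_append_mem_transfiniteDerivative {T H : Set (List S)} {U : Set S}
    (hσ : ∀ s ∈ σ, ∀ N, (fun i => s (i + N)) ∈ σ) (hU : ∀ s ∈ σ, ∀ᶠ i in atTop, s i ∈ U)
    {a γ : Ordinal.{0}} (ha : transfiniteDerivative (sigmaDerivative σ) H a = ∅) {t : List S}
    (ht : t ∈ transfiniteDerivative (sigmaDerivative σ) T (γ + a)) :
    ∃ u : List S, (∀ x ∈ u, x ∈ U) ∧ u ∉ H ∧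
      t ++ u ∈ transfiniteDerivative (sigmaDerivative σ) T γ := by
  by_contra! hcon
  have key : ∀ ξ : Ordinal.{0}, ∀ u : List S, (∀ x ∈ u, x ∈ U) →
      t ++ u ∈ transfiniteDerivative (sigmaDerivative σ) T (γ + ξ) →
      u ∈ transfiniteDerivative (sigmaDerivative σ) H ξ := by
    intro ξ
    induction ξ using Ordinal.limitRecOn with
    | zero =>
      intro u hu htu
      rw [add_zero] at htu
      rw [transfiniteDerivative_zero]
      by_contra huH
      exact hcon u hu huH htu
    | add_one ξ ih =>
      intro u hu htu
      rw [← add_assoc, transfiniteDerivative_add_one] at htu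
      rw [transfiniteDerivative_add_one]
      obtain ⟨htu, s, hs, hts⟩ := htu
      obtain ⟨N, hN⟩ := eventually_atTop.1 (hU s hs)
      refine ⟨ih u hu htu, _, hσ s hs N, fun i => ih _ ?_ ?_⟩
      · intro x hx
        rcases List.mem_append.1 hx with hx | hx
        · exact hu x hx
        · rw [List.mem_singleton.1 hx]
          exact hN _ (Nat.le_add_left _ _)
      · rw [← List.append_assoc]
        exact hts _
    | limit ξ hξ ih =>
      intro u hu htu
      rw [mem_transfiniteDerivative_limit hξ]
      exact fun ζ hζ => ih ζ hζ u hu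
        (antitone_transfiniteDerivative_sigmaDerivative T (by gcongr) htu)
  have := key a [] (by simp) (by simpa using ht)
  rw [ha] at this
  exact this

end SigmaDerivative

/-! ### Lower estimates and convex combinations -/

section LowerEstimate

variable {𝕜 : Type*} [RCLike 𝕜] {X : Type*} [NormedAddCommGroup X] [NormedSpace 𝕜 X]

theorem mem_lowerEstimateTree_of_sublist {ε : ℝ} :
    ∀ t ∈ lowerEstimateTree 𝕜 X ε, ∀ u, u.Sublist t → u ∈ lowerEstimateTree 𝕜 X ε :=
  fun _ ⟨ht, f, hf, hft⟩ _ hu =>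
    ⟨fun x hx => ht x (hu.subset hx), f, hf, fun x hx => hft x (hu.subset hx)⟩

theorem nil_mem_lowerEstimateTree (ε : ℝ) : [] ∈ lowerEstimateTree 𝕜 X ε :=
  ⟨by simp, 0, Metric.mem_closedBall_self zero_le_one, by simp⟩

theorem antitone_weaklyNullIndex_lowerEstimateTree :
    Antitone fun ε => weaklyNullIndex 𝕜 (lowerEstimateTree 𝕜 X ε) := fun _ _ h =>
  derivativeIndex_mono sigmaDerivative_mono
    fun _ ⟨ht, f, hf, hft⟩ => ⟨ht, f, hf, fun x hx => h.trans (hft x hx)⟩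

theorem comp_add_mem_weaklyNullSequences (s : ℕ → X) (hs : s ∈ weaklyNullSequences 𝕜 X) (N : ℕ) :
    (fun i => s (i + N)) ∈ weaklyNullSequences 𝕜 X :=
  ⟨fun _ => hs.1 _, fun f => (hs.2 f).comp (tendsto_add_atTop_nat N)⟩

/-- By Hahn–Banach, a finite sequence in the unit ball outside `H^X_ε` has a convex combination of
norm less than `ε`. -/
theorem exists_mem_convexHull_norm_lt [NormedSpace ℝ X] [IsScalarTower ℝ 𝕜 X] {ε : ℝ} (hε : 0 < ε)
    {t : List X} (ht : ∀ x ∈ t, ‖x‖ ≤ 1) (h : t ∉ lowerEstimateTree 𝕜 X ε) :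
    ∃ y ∈ convexHull ℝ {x | x ∈ t}, ‖y‖ < ε := by
  by_contra! hcon
  have hdisj : Disjoint (Metric.ball (0 : X) ε) (convexHull ℝ {x | x ∈ t}) :=
    disjoint_left.2 fun y hy hy' => (hcon y hy').not_gt (mem_ball_zero_iff.1 hy)
  obtain ⟨f, c, hfc, hcf⟩ := RCLike.geometric_hahn_banach_open (𝕜 := 𝕜) (convex_ball 0 ε)
    Metric.isOpen_ball (convex_convexHull ℝ _) hdisj
  have hc : 0 < c := by simpa using hfc 0 (Metric.mem_ball_self hε)
  have hball : ∀ x ∈ Metric.ball (0 : X) ε, ‖f x‖ ≤ c := by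
    intro x hx
    -- Rotate `x` so that `f` takes the real value `‖f x‖`.
    obtain ⟨z, hz, hzf⟩ := RCLike.exists_norm_eq_mul_self (f x)
    have h1 := hfc (z • x) (by simpa [norm_smul, hz] using hx)
    rw [map_smul, smul_eq_mul, ← hzf, RCLike.ofReal_re] at h1
    exact h1.le
  have hcball : ∀ x ∈ Metric.closedBall (0 : X) ε, ‖f x‖ ≤ c := by
    rw [← closure_ball (0 : X) hε.ne']
    exact fun x hx => closure_minimal (s := Metric.ball (0 : X) ε) (t := {x | ‖f x‖ ≤ c}) hball
      (isClosed_le (by fun_prop) continuous_const) hx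
  have hnorm : ‖f‖ ≤ c / ε := f.opNorm_bound_of_ball_bound hε c hcball
  refine h ⟨ht, ((ε / c : ℝ) : 𝕜) • f, ?_, fun x hx => ?_⟩
  · rw [mem_closedBall_zero_iff, norm_smul, RCLike.norm_ofReal, abs_of_pos (div_pos hε hc)]
    calc ε / c * ‖f‖ ≤ ε / c * (c / ε) := by gcongr
      _ = 1 := by field_simp
  · have h1 := hcf x (subset_convexHull ℝ _ hx)
    rw [smul_apply, smul_eq_mul, RCLike.re_ofReal_mul]
    calc ε = ε / c * c := by field_simp
      _ ≤ ε / c * RCLike.re (f x) := by gcongr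

/-- When the dual is separable, the weak topology of the unit ball has a countable base at `0`, here
formed by the sets `U n` and stated so as to be inherited by convex hulls. -/
theorem exists_weak_nhds_basis [TopologicalSpace.SeparableSpace (StrongDual 𝕜 X)]
    [NormedSpace ℝ X] [IsScalarTower ℝ 𝕜 X] :
    ∃ U : ℕ → Set X, (∀ n, Convex ℝ (U n)) ∧
      (∀ s ∈ weaklyNullSequences 𝕜 X, ∀ n, ∀ᶠ i in atTop, s i ∈ U n) ∧
      ∀ (C : ℝ) (y : ℕ → X), (∀ n, y n ∈ U n) → (∀ n, ‖y n‖ ≤ C) →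
        ∀ f : StrongDual 𝕜 X, Tendsto (fun n => f (y n)) atTop (𝓝 0) := by
  let g := TopologicalSpace.denseSeq (StrongDual 𝕜 X)
  refine ⟨fun n => ⋂ k ∈ Iio n, {x | ‖g k x‖ ≤ ((n : ℝ) + 1)⁻¹}, fun n => ?_, ?_, ?_⟩
  · refine convex_iInter₂ fun k _ => ?_
    have : {x : X | ‖g k x‖ ≤ ((n : ℝ) + 1)⁻¹} =
        ((g k).toLinearMap.restrictScalars ℝ) ⁻¹' Metric.closedBall 0 ((n : ℝ) + 1)⁻¹ := by
      ext x
      simp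
    rw [this]
    exact (convex_closedBall _ _).linear_preimage _
  · intro s hs n
    have : ∀ k ∈ Iio n, ∀ᶠ i in atTop, ‖g k (s i)‖ ≤ ((n : ℝ) + 1)⁻¹ := fun k _ =>
      ((tendsto_zero_iff_norm_tendsto_zero.1 (hs.2 (g k))).eventually_lt_const
        (by positivity)).mono fun _ => le_of_lt
    filter_upwards [(finite_Iio n).eventually_all.2 this] with i hi
    exact mem_iInter₂.2 hi
  · intro C y hyU hyC f
    have hC : 0 ≤ C := (norm_nonneg _).trans (hyC 0)
    rw [Metric.tendsto_atTop]
    intro η hη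
    obtain ⟨k, hk⟩ := (TopologicalSpace.denseRange_denseSeq (StrongDual 𝕜 X)).exists_dist_lt f
      (show 0 < η / (2 * (C + 1)) by positivity)
    obtain ⟨N, hN⟩ := exists_nat_one_div_lt (half_pos hη)
    refine ⟨max N (k + 1), fun n hn => ?_⟩
    have h1 : ‖g k (y n)‖ ≤ ((n : ℝ) + 1)⁻¹ :=
      mem_iInter₂.1 (hyU n) k (lt_of_lt_of_le k.lt_succ_self ((le_max_right _ _).trans hn))
    have h2 : ((n : ℝ) + 1)⁻¹ < η / 2 := by
      rw [one_div] at hN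
      refine lt_of_le_of_lt ?_ hN
      have : (N : ℝ) ≤ n := by exact_mod_cast (le_max_left _ _).trans hn
      gcongr
    have h3 : ‖(f - g k) (y n)‖ ≤ η / 2 := by
      rw [dist_eq_norm] at hk
      calc ‖(f - g k) (y n)‖ ≤ ‖f - g k‖ * ‖y n‖ := (f - g k).le_opNorm _
        _ ≤ η / (2 * (C + 1)) * (C + 1) := by
          gcongr
          exact (hyC n).trans (by linarith)
        _ = η / 2 := by field_simp
    rw [dist_zero_right]
    calc ‖f (y n)‖ = ‖(f - g k) (y n) + g k (y n)‖ := by simp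
      _ ≤ ‖(f - g k) (y n)‖ + ‖g k (y n)‖ := norm_add_le _ _
      _ < η := by linarith

/-- The blocking argument. Let `z` be a sequence in the unit ball that satisfies the lower
`δ`-estimate for every functional with the lower `εδ`-estimate on `t`. Each new entry of `z` is
`ε⁻¹ y`, with `y` a convex combination of norm less than `ε` of a block appended to `t`; `a` steps
in `H_{εδ}` suffice to find such a block, because the index of `H_ε` is at most `a`. -/
theorem mem_transfiniteDerivative_lowerEstimateTree_of_mul
    [TopologicalSpace.SeparableSpace (StrongDual 𝕜 X)] {ε δ : ℝ} (hε : 0 < ε) {a : Ordinal.{0}}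
    (ha : transfiniteDerivative (sigmaDerivative (weaklyNullSequences 𝕜 X))
      (lowerEstimateTree 𝕜 X ε) a = ∅) (ξ : Ordinal.{0}) :
    ∀ t ∈ transfiniteDerivative (sigmaDerivative (weaklyNullSequences 𝕜 X))
        (lowerEstimateTree 𝕜 X (ε * δ)) (a * ξ),
      ∀ z : List X, (∀ x ∈ z, ‖x‖ ≤ 1) →
        (∀ f : StrongDual 𝕜 X, (∀ x ∈ t, ε * δ ≤ RCLike.re (f x)) →
          ∀ x ∈ z, δ ≤ RCLike.re (f x)) →
        z ∈ transfiniteDerivative (sigmaDerivative (weaklyNullSequences 𝕜 X))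
          (lowerEstimateTree 𝕜 X δ) ξ := by
  let : NormedSpace ℝ X := NormedSpace.restrictScalars ℝ 𝕜 X
  have : IsScalarTower ℝ 𝕜 X := Real.isScalarTower
  induction ξ using Ordinal.limitRecOn with
  | zero =>
    simp only [mul_zero, transfiniteDerivative_zero]
    rintro t ⟨-, f, hf, hft⟩ z hz h
    exact ⟨hz, f, hf, h f hft⟩
  | add_one ξ ih =>
    intro t ht z hz hf
    rw [mul_add_one] at ht
    rw [transfiniteDerivative_add_one]
    obtain ⟨U, hUc, hU, hUlim⟩ := exists_weak_nhds_basis (𝕜 := 𝕜) (X := X)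
    have hext : ∀ n, ∃ u : List X, (∀ x ∈ u, x ∈ U n ∩ Metric.closedBall 0 1) ∧
        u ∉ lowerEstimateTree 𝕜 X ε ∧
        t ++ u ∈ transfiniteDerivative (sigmaDerivative (weaklyNullSequences 𝕜 X))
          (lowerEstimateTree 𝕜 X (ε * δ)) (a * ξ) := fun n =>
      exists_append_mem_transfiniteDerivative comp_add_mem_weaklyNullSequences
        (fun s hs => (hU s hs n).and (Eventually.of_forall fun i =>
          mem_closedBall_zero_iff.2 (hs.1 i))) ha ht
    choose u hu huH htu using hext
    choose y hy hyε using fun n => exists_mem_convexHull_norm_lt hε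
      (fun x hx => mem_closedBall_zero_iff.1 (hu n x hx).2) (huH n)
    have hyU : ∀ n, y n ∈ U n := fun n =>
      convexHull_min (fun x hx => (hu n x hx).1) (hUc n) (hy n)
    have hw : ∀ n, ‖((ε⁻¹ : ℝ) : 𝕜) • y n‖ ≤ 1 := fun n => by
      rw [norm_smul, RCLike.norm_ofReal, abs_of_pos (inv_pos.2 hε), inv_mul_le_iff₀ hε, mul_one]
      exact (hyε n).le
    have hyf : ∀ n, ∀ f : StrongDual 𝕜 X, (∀ x ∈ u n, ε * δ ≤ RCLike.re (f x)) →
        δ ≤ RCLike.re (f (((ε⁻¹ : ℝ) : 𝕜) • y n)) := fun n f hfu => by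
      have hconv : Convex ℝ {x : X | ε * δ ≤ RCLike.re (f x)} :=
        convex_halfSpace_ge (f := fun x => RCLike.re (f x))
          ((RCLike.reLm.comp (f.toLinearMap.restrictScalars ℝ)).isLinear) _
      have h1 : ε * δ ≤ RCLike.re (f (y n)) := convexHull_min hfu hconv (hy n)
      rw [map_smul, smul_eq_mul, RCLike.re_ofReal_mul, le_inv_mul_iff₀ hε]
      exact h1
    refine ⟨ih t (antitone_transfiniteDerivative_sigmaDerivative _ le_self_add ht) z hz hf,
      fun n => ((ε⁻¹ : ℝ) : 𝕜) • y n, ⟨hw, fun f => ?_⟩, fun n => ih _ (htu n) _ ?_ ?_⟩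
    · simpa using (hUlim ε y hyU (fun n => (hyε n).le) f).const_mul ((ε⁻¹ : ℝ) : 𝕜)
    · intro x hx
      rcases List.mem_append.1 hx with hx | hx
      · exact hz x hx
      · exact List.mem_singleton.1 hx ▸ hw n
    · intro f hft x hx
      rcases List.mem_append.1 hx with hx | hx
      · exact hf f (fun x hx => hft x (List.mem_append_left _ hx)) x hx
      · exact List.mem_singleton.1 hx ▸
          hyf n f fun x hx => hft x (List.mem_append_right _ hx)
  | limit ξ hξ ih =>
    intro t ht z hz hf
    rw [mem_transfiniteDerivative_limit hξ]
    exact fun ζ hζ => ih ζ hζ t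
      (antitone_transfiniteDerivative_sigmaDerivative _ (mul_le_mul_right hζ.le a) ht) z hz hf

theorem weaklyNullIndex_lowerEstimateTree_mul_le
    [TopologicalSpace.SeparableSpace (StrongDual 𝕜 X)] {ε δ : ℝ} (hε : 0 < ε) :
    weaklyNullIndex 𝕜 (lowerEstimateTree 𝕜 X (ε * δ)) ≤
      weaklyNullIndex 𝕜 (lowerEstimateTree 𝕜 X ε) *
        weaklyNullIndex 𝕜 (lowerEstimateTree 𝕜 X δ) := by
  refine derivativeIndex_le_mul ⟨_, nil_mem_lowerEstimateTree ε⟩ ⟨_, nil_mem_lowerEstimateTree δ⟩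
    fun a ha b hb => eq_empty_of_forall_notMem fun t ht => ?_
  have := mem_transfiniteDerivative_lowerEstimateTree_of_mul hε ha b t ht [] (by simp) (by simp)
  rw [hb] at this
  exact this

theorem omega0_opow_omega0_opow_lt_weaklyNullIndex
    [TopologicalSpace.SeparableSpace (StrongDual 𝕜 X)] {ε δ : ℝ} (hε : 0 < ε)
    (hδ : δ ∈ Ioo (0 : ℝ) 1) {ξ : Ordinal.{0}}
    (h : ω ^ ω ^ ξ < weaklyNullIndex 𝕜 (lowerEstimateTree 𝕜 X ε)) :
    ω ^ ω ^ ξ < weaklyNullIndex 𝕜 (lowerEstimateTree 𝕜 X δ) := by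
  by_contra! hle
  have hξ : ω ^ ω ^ ξ < ω₁ := h.trans_le (derivativeIndex_le_omega_one _ _)
  have hlt : weaklyNullIndex 𝕜 (lowerEstimateTree 𝕜 X δ) < ω ^ ω ^ ξ := by
    refine hle.lt_of_ne fun heq => ?_
    exact not_isSuccLimit_derivativeIndex_sigmaDerivative mem_lowerEstimateTree_of_sublist
      (hle.trans_lt hξ) (heq.symm ▸ isSuccLimit_omega0_opow_omega0_opow ξ :
        Order.IsSuccLimit (weaklyNullIndex 𝕜 (lowerEstimateTree 𝕜 X δ)))
  exact h.not_gt (lt_omega0_opow_omega0_opow_of_submultiplicative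
    antitone_weaklyNullIndex_lowerEstimateTree
    (fun _ hε _ _ => weaklyNullIndex_lowerEstimateTree_mul_le hε.1) hδ hlt hε)

end LowerEstimate

theorem theorem5p10 {𝕜 : Type*} [RCLike 𝕜] :
    (∀ (X : Type*) [NormedAddCommGroup X] [NormedSpace 𝕜 X] [CompleteSpace X]
        [TopologicalSpace.SeparableSpace (StrongDual 𝕜 X)],
      (∀ ε ∈ Set.Ioo (0 : ℝ) 1, ∀ δ ∈ Set.Ioo (0 : ℝ) 1,
        weaklyNullIndex 𝕜 (lowerEstimateTree 𝕜 X (ε * δ)) ≤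
          weaklyNullIndex 𝕜 (lowerEstimateTree 𝕜 X ε) *
            weaklyNullIndex 𝕜 (lowerEstimateTree 𝕜 X δ)) ∧
      (∀ ε ∈ Set.Ioo (0 : ℝ) 1, ∀ δ ∈ Set.Ioo (0 : ℝ) 1, ∀ ξ : Ordinal.{0},
        ω ^ ω ^ ξ < weaklyNullIndex 𝕜 (lowerEstimateTree 𝕜 X ε) →
          ω ^ ω ^ ξ < weaklyNullIndex 𝕜 (lowerEstimateTree 𝕜 X δ)) ∧
      (∀ η : Ordinal.{0}, Order.IsSuccLimit η → η < ω₁ → szlenkIndex 𝕜 X ≠ ω ^ ω ^ η)) ∧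
    (∀ (Y : Type*) [NormedAddCommGroup Y] [NormedSpace 𝕜 Y] [CompleteSpace Y],
      ∀ η : Ordinal.{0}, Order.IsSuccLimit η → η < ω₁ → szlenkIndex 𝕜 Y ≠ ω ^ ω ^ η) := by
  refine ⟨fun X _ _ _ _ => ⟨fun ε hε δ _ => weaklyNullIndex_lowerEstimateTree_mul_le hε.1,
    fun ε hε δ hδ ξ h => omega0_opow_omega0_opow_lt_weaklyNullIndex hε.1 hδ h,
    fun η hη hη₁ => szlenkIndex_ne_omega0_opow_omega0_opow hη hη₁⟩,
    fun Y _ _ _ η hη hη₁ => szlenkIndex_ne_omega0_opow_omega0_opow hη hη₁⟩
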